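/- Let $X$ be a finite-dimensional real vector space with a polyhedral norm $\|\cdot\|$, that is, a positively homogeneous, subadditive, positive definite function (symmetry $\|-x\|=\|x\|$ is not required) whose unit ball $B=\{x:\|x\|\le 1\}$ is a polytope. Fix a Euclidean inner product on $X$. Let $B^\circ=\{y\in X^*: \langle y|x\rangle\ge -1 \text{ for all } x\in B\}$ be the dual unit ball, a polytope in $X^*$. Let $\widetilde C(X)$ be the space of continuous real functions on $X$, with the topology of uniform convergence on bounded sets, modulo constant functions. Let $\psi: X\to\widetilde C(X)$ send $z$ to the class of $\psi_z(y)=\|z-y\|-\|z\|$. Let $\overline{X}^{hor}$, the horofunction compactification, be the closure of $\psi(X)$ in $\widetilde C(X)$, and let $\partial_{hor}X=\overline{X}^{hor}\setminus\psi(X)$. For a proper face $E$ of $B^\circ$ (nonempty and different from $B^\circ$) let $E^\circ=\{x\in B:\langle e|x\rangle=-1 \text{ for all } e\in E\}$ be the dual face of $B$, let $V(E^\circ)$ be its linear span, and for $p\in V(E^\circ)^\perp$ put $$h_{E,p}(y)=|p-y|_E-|p|_E,\qquad |x|_E=-\inf_{q\in E}\langle q|x\rangle .$$ For a polytope $C\subset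 X^*$ with vertices $c_1,\dots,c_r$ put $$m^C(x)=\sum_{i=1}^r\frac{e^{-\langle c_i|x\rangle}}{\sum_{k=1}^r e^{-\langle c_k|x\rangle}}\,c_i .$$ Then $\psi$ is a topological embedding, $\partial_{hor}X$ is exactly the set of the (classes of the) functions $h_{E,p}$ with $E$ a proper face of $B^\circ$ and $p\in V(E^\circ)^\perp$, and there is a homeomorphism $m:\overline{X}^{hor}\to B^\circ$ with $m(\psi_x)=m^{B^\circ}(x)$ for all $x\in X$ and $m(h_{E,p})=m^E(p)$ for all such $E$ and $p$. -/

import Mathlib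

open Set Filter Topology

noncomputable section

/-- A polyhedral norm on a finite-dimensional real vector space `X`: a positively homogeneous,
subadditive, positive definite function whose unit ball is a polytope (the convex hull of a finite
set). Every norm in the usual sense with a polytope as unit ball is an instance. The symmetry
`N (-x) = N x` is not required, so the unit ball may be any polytope with the origin in its
interior. -/
structure PolyhedralNorm (X : Type*) [AddCommGroup X] [Module ℝ X] where
  /-- the underlying function -/
  toFun : X → ℝ
  add_le : ∀ x y, toFun (x + y) ≤ toFun x + toFun y
  smul_of_nonneg : ∀ (c : ℝ) (x : X), 0 ≤ c → toFun (c • x) = c * toFun x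
  pos_of_ne_zero : ∀ x, x ≠ 0 → 0 < toFun x
  polyhedral : ∃ S : Finset X, {x | toFun x ≤ 1} = convexHull ℝ (S : Set X)

/-- The subspace of constant functions in `C(X, ℝ)`. -/
def constantFunctions (X : Type*) [TopologicalSpace X] : Submodule ℝ C(X, ℝ) where
  carrier := {f | ∃ c : ℝ, ∀ x, f x = c}
  add_mem' := by
    rintro f g ⟨c, hc⟩ ⟨d, hd⟩
    exact ⟨c + d, fun x => by simp [hc, hd]⟩
  zero_mem' := ⟨0, fun x => rfl⟩
  smul_mem' := by
    rintro r f ⟨c, hc⟩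
    exact ⟨r * c, fun x => by simp [hc]⟩

/-- The space of continuous real functions on `X` modulo constant functions. `C(X, ℝ)` carries the
compact-open topology, which is the topology of uniform convergence on bounded subsets because
closed balls of the finite-dimensional space `X` are compact; the quotient carries the quotient
topology. -/
abbrev FunctionsModConstants (X : Type*) [TopologicalSpace X] : Type _ :=
  C(X, ℝ) ⧸ constantFunctions X

/-- The pseudo-norm `|x|_R = - inf_{q ∈ R} ⟨q | x⟩` of a set `R` in the dual space. -/
def pseudoNorm {X : Type*} [NormedAddCommGroup X] [NormedSpace ℝ X]
    (R : Set (StrongDual ℝ X)) (x : X) : ℝ :=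
  -sInf ((fun q : StrongDual ℝ X => q x) '' R)

/-- The map `m^C` of a polytope `C ⊆ X*` with vertices `c₁, …, c_r`:
`m^C(x) = ∑ᵢ (e^{-⟨cᵢ | x⟩} / ∑ₖ e^{-⟨cₖ | x⟩}) cᵢ`. The vertices of `C` are its extreme points;
the sums are finite sums as a polytope has finitely many of them. -/
def momentMap {X : Type*} [NormedAddCommGroup X] [NormedSpace ℝ X]
    (C : Set (StrongDual ℝ X)) (x : X) : StrongDual ℝ X :=
  ∑ᶠ c ∈ C.extremePoints ℝ,
    (Real.exp (-(c x)) / ∑ᶠ d ∈ C.extremePoints ℝ, Real.exp (-(d x))) • c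

namespace PolyhedralNorm

section Basic

variable {X : Type*} [NormedAddCommGroup X] [InnerProductSpace ℝ X]

instance : CoeFun (PolyhedralNorm X) (fun _ => X → ℝ) := ⟨PolyhedralNorm.toFun⟩

/-- The unit ball `B` of the norm `N`. -/
def unitBall (N : PolyhedralNorm X) : Set X := {x | N x ≤ 1}

/-- The dual unit ball `B°`, the polar of `B`, with the sign convention `⟨y | x⟩ ≥ -1`. -/
def dualUnitBall (N : PolyhedralNorm X) : Set (StrongDual ℝ X) :=
  {y | ∀ x ∈ N.unitBall, -1 ≤ y x}

variable [FiniteDimensional ℝ X]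

theorem continuous (N : PolyhedralNorm X) : Continuous N := by
  have hc : ConvexOn ℝ univ N := by
    refine ⟨convex_univ, fun x _ y _ a b ha hb _ => ?_⟩
    calc N (a • x + b • y) ≤ N (a • x) + N (b • y) := N.add_le _ _
      _ = a • N x + b • N y := by
        rw [N.smul_of_nonneg a x ha, N.smul_of_nonneg b y hb]; rfl
  exact continuousOn_univ.1 (hc.continuousOn isOpen_univ)

theorem isCompact_dualUnitBall (N : PolyhedralNorm X) : IsCompact N.dualUnitBall := by
  have h0 : N 0 = 0 := by simpa using N.smul_of_nonneg 0 0 le_rfl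
  have hB : N.unitBall ∈ 𝓝 (0 : X) := by
    have h : {x | N x < 1} ∈ 𝓝 (0 : X) :=
      (isOpen_lt N.continuous continuous_const).mem_nhds (by simp [h0])
    exact mem_of_superset h fun x (hx : N x < 1) => show N x ≤ 1 from hx.le
  obtain ⟨r, hr, hrB⟩ := Metric.nhds_basis_closedBall.mem_iff.1 hB
  have hb : Bornology.IsBounded N.dualUnitBall := by
    refine (NormedSpace.isBounded_polar_of_mem_nhds_zero ℝ
      (Metric.closedBall_mem_nhds (0 : X) hr)).subset ?_
    intro y hy
    rw [StrongDual.mem_polar_iff]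
    intro x hx
    have h1 := hy x (hrB hx)
    have h2 := hy (-x) (hrB (by simpa using hx))
    rw [Real.norm_eq_abs, abs_le]
    rw [map_neg] at h2
    exact ⟨h1, by linarith⟩
  have hcl : IsClosed N.dualUnitBall := by
    have : N.dualUnitBall = ⋂ x ∈ N.unitBall, {y : StrongDual ℝ X | -1 ≤ y x} := by
      ext y; simp [dualUnitBall]
    rw [this]
    exact isClosed_biInter fun x _ =>
      isClosed_le continuous_const (ContinuousLinearMap.apply ℝ ℝ x).continuous
  have : ProperSpace (StrongDual ℝ X) := FiniteDimensional.proper ℝ _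
  exact Metric.isCompact_of_isClosed_isBounded hcl hb

/-- The function `y ↦ ‖z - y‖ - ‖z‖`, that is `d(·, z) - d(0, z)`, with base point `0`. -/
def distanceFunction (N : PolyhedralNorm X) (z : X) : C(X, ℝ) where
  toFun y := N (z - y) - N z
  continuous_toFun := (N.continuous.comp (continuous_const.sub continuous_id)).sub continuous_const

/-- The map `ψ` of `X` into the continuous functions modulo constants. -/
def psi (N : PolyhedralNorm X) (z : X) : FunctionsModConstants X :=
  Submodule.Quotient.mk (N.distanceFunction z)

/-- The horofunction compactification of `X` with respect to `N`: the closure of `ψ(X)`. -/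
def horofunctionCompactification (N : PolyhedralNorm X) : Set (FunctionsModConstants X) :=
  closure (range N.psi)

/-- The horofunction boundary: `cl ψ(X) ∖ ψ(X)`. -/
def horofunctionBoundary (N : PolyhedralNorm X) : Set (FunctionsModConstants X) :=
  N.horofunctionCompactification \ range N.psi

/-- The proper faces of the polytope `B°`: the sets different from `∅` and `B°` on which some
linear functional attains its maximum over `B°`. -/
structure ProperDualFace (N : PolyhedralNorm X) where
  /-- the underlying set of the face -/
  carrier : Set (StrongDual ℝ X)
  isExposed : IsExposed ℝ N.dualUnitBall carrier
  nonempty : carrier.Nonempty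
  ne_dualUnitBall : carrier ≠ N.dualUnitBall

namespace ProperDualFace

variable {N : PolyhedralNorm X}

/-- The face `E°` of `B` dual to the face `E` of `B°`, given by `⟨e | f⟩ = -1` for all `e ∈ E`. -/
def dualFace (E : N.ProperDualFace) : Set X :=
  {x ∈ N.unitBall | ∀ e ∈ E.carrier, e x = -1}

/-- The orthogonal complement `V(E°)^⊥` of the linear span of the dual face, with respect to the
auxiliary Euclidean inner product on `X`. -/
def parameterSpace (E : N.ProperDualFace) : Submodule ℝ X :=
  (Submodule.span ℝ E.dualFace)ᗮ

theorem continuous_pseudoNorm (E : N.ProperDualFace) : Continuous (pseudoNorm E.carrier) := by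
  have hf : Continuous (Function.uncurry fun (x : X) (q : StrongDual ℝ X) => q x) := by
    unfold Function.uncurry
    fun_prop
  exact ((E.isExposed.isCompact N.isCompact_dualUnitBall).continuous_sInf hf).neg

/-- The function `h_{E,p}(y) = |p - y|_E - |p|_E`. -/
def horofunction (E : N.ProperDualFace) (p : X) : C(X, ℝ) where
  toFun y := pseudoNorm E.carrier (p - y) - pseudoNorm E.carrier p
  continuous_toFun :=
    (E.continuous_pseudoNorm.comp (continuous_const.sub continuous_id)).sub continuous_const

/-- The class of `h_{E,p}` modulo constants. -/
def horofunctionClass (E : N.ProperDualFace) (p : X) : FunctionsModConstants X :=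
  Submodule.Quotient.mk (E.horofunction p)

end ProperDualFace

end Basic

end PolyhedralNorm

end

/-!
Let `c₁, …, c_r` be the vertices of the dual unit ball `B°`. There are finitely many, since a vertex
`y` is determined by the points `s` of a finite set spanning `B` at which the constraint
`-1 ≤ ⟨y | s⟩` is tight, and `‖x‖ = maxᵢ -⟨cᵢ | x⟩`. Both the compactification and `B°` are described
by one compact set of weights.

For a face `E` of `B°` (here `E = B°` is allowed) and `p ∈ X` let `w(E, p)` be the point of the
standard simplex with weights proportional to `exp (-⟨cᵢ | p⟩)` on the vertices in `E` and zero
elsewhere (`gibbs`). Let `T` be the closure of the set of all `w(B°, x)`, `x ∈ X`. It consists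
exactly of the `w(E, p)`: such weights are limits along a ray that exposes `E`
(`gibbs_mem_closure_range`), and conversely the convergence of the log-ratios of the weights, which
are linear in `x`, yields both `p` and a functional exposing the support
(`exists_eq_gibbs_of_mem_closure`).

Two continuous maps start from `T`.

* The barycenter map `w ↦ ∑ᵢ wᵢ cᵢ` sends `w(E, p)` to `m^E(p)`. It is injective on `T`: the
  barycenter determines the face, and for two elements with the same support `A` and the same
  barycenter, `∑ (wᵢ - wᵢ') (log wᵢ - log wᵢ')` over `A` vanishes while its terms are nonnegative
  (`gibbs_eq_of_barycenter_eq`). Its image is `B°`: a point `t q` with `q ∈ B°`, `0 < t < 1` is the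
  barycenter at the minimum of `x ↦ log (∑ exp (-⟨cᵢ | x⟩)) + t ⟨q | x⟩`, and the image is closed
  (`dualUnitBall_subset_image_barycenter`).
* The max-plus map sends `w` to the class of `y ↦ log (maxᵢ wᵢ exp ⟨cᵢ | y⟩)`, and `w(E, p)` to the
  class of `h_{E,p}`, which is that of `ψ_p` for `E = B°` (`maxPlusClass_gibbs`). It is injective on
  the whole simplex, because each vertex `cᵢ` is exposed and `wᵢ` can be read off along an exposing
  ray (`injective_maxPlusClass`). So it is a closed embedding, and it maps `T` onto the closure of
  `ψ(X)`.

The homeomorphism is the barycenter map after the inverse of the max-plus map. The boundary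
consists of the images of the `w(E, p)` with `E ≠ B°`, and `p` can be moved into `V(E°)^⊥` because the
vertices of `E` agree on `V(E°)`. Finally `ψ` is an embedding, since `x` depends linearly on the
log-ratios of `w(B°, x)`.
-/

open Set Filter Topology

noncomputable section

/-! ### Functions modulo constants, and support functions of polytopes -/

section FunctionsModConstants

variable {X : Type*} [NormedAddCommGroup X]

theorem mk_functionsModConstants_eq_iff {f g : C(X, ℝ)} :
    (Submodule.Quotient.mk f : FunctionsModConstants X) = Submodule.Quotient.mk g ↔
      ∃ b, ∀ y, f y - g y = b :=
  Submodule.Quotient.eq _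

theorem isClosed_constantFunctions : IsClosed (constantFunctions X : Set C(X, ℝ)) := by
  have h : (constantFunctions X : Set C(X, ℝ)) = ⋂ x, {f | f x = f 0} := by
    ext f
    simp only [mem_iInter, mem_ofPred_eq]
    exact ⟨fun ⟨b, hb⟩ x => by rw [hb, hb], fun h => ⟨f 0, h⟩⟩
  rw [h]
  exact isClosed_iInter fun x => isClosed_eq (by fun_prop) (by fun_prop)

end FunctionsModConstants

theorem exp_sub_const_div_sum {ι : Type*} {B : Finset ι} (f : ι → ℝ) (b : ℝ) (i : ι) :
    Real.exp (f i - b) / ∑ j ∈ B, Real.exp (f j - b) =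
      Real.exp (f i) / ∑ j ∈ B, Real.exp (f j) := by
  simp_rw [Real.exp_sub]
  rw [← Finset.sum_div, div_div_div_cancel_right₀ (Real.exp_pos b).ne']

/-- The infimum that defines the pseudo-norm of a polytope is attained at one of the
points that span it. -/
theorem isGreatest_pseudoNorm_convexHull {X ι : Type*} [NormedAddCommGroup X]
    [NormedSpace ℝ X] {c : ι → StrongDual ℝ X} {A : Finset ι} (hA : A.Nonempty) (x : X) :
    IsGreatest ((fun i => -(c i x)) '' A) (pseudoNorm (convexHull ℝ (c '' A)) x) := by
  obtain ⟨i, hi, hmin⟩ := A.exists_min_image (fun i => c i x) hA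
  have h : IsLeast ((fun q : StrongDual ℝ X => q x) '' convexHull ℝ (c '' A)) (c i x) := by
    refine ⟨⟨c i, subset_convexHull ℝ _ (mem_image_of_mem c hi), rfl⟩, ?_⟩
    rintro _ ⟨q, hq, rfl⟩
    have hconv : Convex ℝ {q : StrongDual ℝ X | c i x ≤ q x} :=
      convex_halfSpace_ge ⟨fun _ _ => rfl, fun _ _ => rfl⟩ _
    refine convexHull_min ?_ hconv hq
    rintro _ ⟨j, hj, rfl⟩
    exact hmin j hj
  rw [pseudoNorm, h.csInf_eq]
  refine ⟨⟨i, hi, rfl⟩, ?_⟩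
  rintro _ ⟨j, hj, rfl⟩
  exact neg_le_neg (hmin j hj)

/-! ### Gibbs weights and their limits -/

section Gibbs

variable {X ι : Type*} [NormedAddCommGroup X] [NormedSpace ℝ X] [Fintype ι]

open scoped Classical in
/-- The point of the standard simplex with weights proportional to `exp (-⟨cᵢ | p⟩)` for `i ∈ A`,
and zero weights outside `A`. -/
def gibbs (c : ι → StrongDual ℝ X) {A : Finset ι} (hA : A.Nonempty) (p : X) : stdSimplex ℝ ι :=
  ⟨fun i => if i ∈ A then Real.exp (-(c i p)) / ∑ j ∈ A, Real.exp (-(c j p)) else 0, by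
    have hZ : 0 < ∑ j ∈ A, Real.exp (-(c j p)) := Finset.sum_pos (fun i _ => Real.exp_pos _) hA
    refine ⟨fun i => ?_, ?_⟩
    · dsimp only
      split_ifs
      · positivity
      · exact le_rfl
    · rw [Finset.sum_ite_mem, Finset.univ_inter, ← Finset.sum_div, div_self hZ.ne']⟩

/-- The Gibbs weights that charge all indices. -/
abbrev gibbsUniv [Nonempty ι] (c : ι → StrongDual ℝ X) (p : X) : stdSimplex ℝ ι :=
  gibbs c Finset.univ_nonempty p

/-- The points `cᵢ` with `i ∈ A` are exactly those on which the evaluation at some `u` is minimal.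
So `A` indexes the points on a face, possibly empty or improper, of the polytope spanned by the
`cᵢ`. -/
def IsVertexSetOfFace (c : ι → StrongDual ℝ X) (A : Finset ι) : Prop :=
  ∃ (u : X) (a : ℝ), (∀ i ∈ A, c i u = a) ∧ ∀ i, i ∉ A → a < c i u

variable {c : ι → StrongDual ℝ X} {A A' : Finset ι} {hA : A.Nonempty} {hA' : A'.Nonempty} {p p' : X}

theorem gibbs_apply_of_mem {i : ι} (hi : i ∈ A) :
    gibbs c hA p i = Real.exp (-(c i p)) / ∑ j ∈ A, Real.exp (-(c j p)) :=
  if_pos hi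

theorem gibbs_apply_of_notMem {i : ι} (hi : i ∉ A) : gibbs c hA p i = 0 :=
  if_neg hi

theorem gibbs_pos {i : ι} (hi : i ∈ A) : 0 < gibbs c hA p i := by
  rw [gibbs_apply_of_mem hi]
  exact div_pos (Real.exp_pos _) (Finset.sum_pos (fun i _ => Real.exp_pos _) hA)

theorem gibbs_pos_iff {i : ι} : 0 < gibbs c hA p i ↔ i ∈ A :=
  ⟨fun h => by_contra fun hi => h.ne' (gibbs_apply_of_notMem hi), gibbs_pos⟩

theorem log_gibbs {i : ι} (hi : i ∈ A) :
    Real.log (gibbs c hA p i) = -(c i p) - Real.log (∑ j ∈ A, Real.exp (-(c j p))) := by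
  have hZ : 0 < ∑ j ∈ A, Real.exp (-(c j p)) := Finset.sum_pos (fun i _ => Real.exp_pos _) hA
  rw [gibbs_apply_of_mem hi, Real.log_div (Real.exp_pos _).ne' hZ.ne', Real.log_exp]

theorem sum_gibbs_smul : ∑ i, gibbs c hA p i • c i =
    ∑ i ∈ A, (Real.exp (-(c i p)) / ∑ j ∈ A, Real.exp (-(c j p))) • c i := by
  rw [← Finset.sum_subset (Finset.subset_univ A)
    fun i _ hi => by rw [gibbs_apply_of_notMem hi, zero_smul]]
  exact Finset.sum_congr rfl fun i hi => by rw [gibbs_apply_of_mem hi]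

/-- Gibbs weights on `A` are determined by the log-ratios on `A`. -/
theorem eq_gibbs_of_log_sub_log {w : stdSimplex ℝ ι} {i₀ : ι} (h₀ : i₀ ∈ A)
    (hw : ∀ i, 0 < w i ↔ i ∈ A)
    (h : ∀ i ∈ A, Real.log (w i₀) - Real.log (w i) = c i p - c i₀ p) : w = gibbs c hA p := by
  have key : ∀ i ∈ A, w i = w i₀ * Real.exp (c i₀ p) * Real.exp (-(c i p)) := by
    intro i hi
    have h1 : Real.log (w i) = Real.log (w i₀) + c i₀ p + -(c i p) := by linarith [h i hi]
    rw [← Real.exp_log ((hw i).2 hi), h1, Real.exp_add, Real.exp_add, Real.exp_log ((hw i₀).2 h₀)]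
  have hzero : ∀ i, i ∉ A → w i = 0 := fun i hi =>
    le_antisymm (not_lt.1 fun h => hi ((hw i).1 h)) (w.2.1 i)
  have hsum : ∑ i ∈ A, w i = 1 := by
    rw [Finset.sum_subset (Finset.subset_univ A) fun i _ hi => hzero i hi]
    exact w.2.2
  rw [Finset.sum_congr rfl key, ← Finset.mul_sum] at hsum
  ext i
  by_cases hi : i ∈ A
  · have hZ : 0 < ∑ j ∈ A, Real.exp (-(c j p)) := Finset.sum_pos (fun i _ => Real.exp_pos _) hA
    rw [gibbs_apply_of_mem hi, key i hi, eq_div_iff hZ.ne', mul_right_comm, hsum, one_mul]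
  · rw [gibbs_apply_of_notMem hi, hzero i hi]

/-- Gibbs weights only depend on the differences `⟨cᵢ - cⱼ | p⟩`. -/
theorem gibbs_add_of_forall_eq {k : X} (hk : ∀ i ∈ A, ∀ j ∈ A, c i k = c j k) :
    gibbs c hA (k + p) = gibbs c hA p := by
  obtain ⟨i₀, h₀⟩ := id hA
  refine eq_gibbs_of_log_sub_log h₀ (fun i => gibbs_pos_iff) fun i hi => ?_
  rw [log_gibbs h₀, log_gibbs hi, map_add, map_add, hk i hi i₀ h₀]
  ring

theorem tendsto_stdSimplex_iff {α : Type*} {l : Filter α} {f : α → stdSimplex ℝ ι}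
    {w : stdSimplex ℝ ι} : Tendsto f l (𝓝 w) ↔ ∀ i, Tendsto (fun a => f a i) l (𝓝 (w i)) :=
  tendsto_subtype_rng.trans tendsto_pi_nhds

theorem continuous_gibbs : Continuous (gibbs c hA) := by
  refine Continuous.subtype_mk (continuous_pi fun i => ?_) _
  split_ifs
  · refine Continuous.div (by fun_prop) (by fun_prop) fun p => ?_
    exact (Finset.sum_pos (fun i _ => Real.exp_pos _) hA).ne'
  · exact continuous_const

/-- Gibbs weights on a face are limits of Gibbs weights on all indices, along a ray that exposes
the face. -/
theorem gibbs_mem_closure_range [Nonempty ι] (h : IsVertexSetOfFace c A) :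
    gibbs c hA p ∈ closure (range (gibbsUniv c)) := by
  obtain ⟨u, a, hu, hu'⟩ := h
  classical
  have key : ∀ i, Tendsto (fun t : ℝ => Real.exp (-(c i (p + t • u)) - -(t * a))) atTop
      (𝓝 (if i ∈ A then Real.exp (-(c i p)) else 0)) := by
    intro i
    have h1 : ∀ t : ℝ, -(c i (p + t • u)) - -(t * a) = -(c i p) - t * (c i u - a) := by
      intro t
      simp only [map_add, map_smul, smul_eq_mul]
      ring
    simp_rw [h1]
    split_ifs with hi
    · simp [hu i hi]
    · refine Real.tendsto_exp_atBot.comp ?_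
      refine tendsto_atBot_add_const_left _ _ (tendsto_neg_atTop_atBot.comp ?_)
      exact tendsto_id.atTop_mul_const (sub_pos.2 (hu' i hi))
  have hZ : 0 < ∑ j ∈ A, Real.exp (-(c j p)) := Finset.sum_pos (fun i _ => Real.exp_pos _) hA
  refine mem_closure_of_tendsto (f := fun t : ℝ => gibbsUniv c (p + t • u)) (b := atTop) ?_
    (Eventually.of_forall fun t => mem_range_self _)
  refine tendsto_stdSimplex_iff.2 fun i => ?_
  have hlim := (key i).div (tendsto_finsetSum Finset.univ fun j _ => key j) (by
    rw [Finset.sum_ite_mem, Finset.univ_inter]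
    exact hZ.ne')
  rw [Finset.sum_ite_mem, Finset.univ_inter, ite_div, zero_div] at hlim
  refine hlim.congr fun t => ?_
  rw [gibbs_apply_of_mem (Finset.mem_univ i)]
  exact exp_sub_const_div_sum (fun j => -(c j (p + t • u))) (-(t * a)) i

/-- The boundary points of the set of Gibbs weights: if weights `w` are a limit of Gibbs weights at
`xₙ`, the log-ratios of `xₙ` on the support `A` of `w` converge. As these are linear in `xₙ`, one
can write `xₙ = kₙ + rₙ` where `rₙ` converges and `kₙ` does not change the ratios on `A`; then `kₙ`
exposes `A` for large `n`. -/
theorem exists_eq_gibbs_of_mem_closure [FiniteDimensional ℝ X] [Nonempty ι] {w : stdSimplex ℝ ι}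
    (hw : w ∈ closure (range (gibbsUniv c))) :
    ∃ (A : Finset ι) (hA : A.Nonempty) (p : X), IsVertexSetOfFace c A ∧ w = gibbs c hA p := by
  classical
  obtain ⟨v, hv, hlim⟩ := mem_closure_iff_seq_limit.1 hw
  choose x hx using hv
  obtain rfl : (fun n => gibbsUniv c (x n)) = v := funext hx
  rw [tendsto_stdSimplex_iff] at hlim
  set A : Finset ι := Finset.univ.filter fun i => 0 < w i with hAdef
  have hmem : ∀ i, 0 < w i ↔ i ∈ A := fun i => by simp [hAdef]
  have hA : A.Nonempty := by
    by_contra h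
    have h0 : ∀ i, w i = 0 := fun i =>
      le_antisymm (not_lt.1 fun hi => h ⟨i, (hmem i).1 hi⟩) (w.2.1 i)
    have h1 : ∑ i, w i = 1 := w.2.2
    simp [h0] at h1
  obtain ⟨i₀, h₀⟩ := id hA
  have hlog : ∀ i n, c i (x n) - c i₀ (x n) =
      Real.log (gibbsUniv c (x n) i₀) - Real.log (gibbsUniv c (x n) i) := by
    intro i n
    rw [log_gibbs (Finset.mem_univ _), log_gibbs (Finset.mem_univ _)]
    ring
  have hlog₀ : Tendsto (fun n => Real.log (gibbsUniv c (x n) i₀)) atTop (𝓝 (Real.log (w i₀))) :=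
    (hlim i₀).log ((hmem i₀).2 h₀).ne'
  let Φ : X →ₗ[ℝ] (A → ℝ) :=
    LinearMap.pi fun i => ((c i - c i₀ : StrongDual ℝ X) : X →ₗ[ℝ] ℝ)
  have hΦ : ∀ y (i : A), Φ y i = c i y - c i₀ y := fun y i => rfl
  have hΦlim : Tendsto (fun n => Φ (x n)) atTop
      (𝓝 fun i : A => Real.log (w i₀) - Real.log (w i)) := by
    refine tendsto_pi_nhds.2 fun i => ?_
    simp_rw [hΦ, hlog]
    exact hlog₀.sub ((hlim i).log ((hmem i).2 i.2).ne')
  -- A linear section `g` of `Φ` over its range; it is continuous.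
  obtain ⟨g₀, hg₀⟩ := Φ.rangeRestrict.exists_rightInverse_of_surjective Φ.range_rangeRestrict
  obtain ⟨g, hg⟩ := g₀.exists_extend
  have hΦg : ∀ y, Φ (g (Φ y)) = Φ y := by
    intro y
    have h1 : g (Φ y) = g₀ (Φ.rangeRestrict y) := by
      rw [← hg]; rfl
    rw [h1]
    exact congrArg Subtype.val (LinearMap.congr_fun hg₀ (Φ.rangeRestrict y))
  have hglim := (g.continuous_of_finiteDimensional.tendsto _).comp hΦlim
  set p := g fun i : A => Real.log (w i₀) - Real.log (w i)
  have hΦp : Φ p = fun i : A => Real.log (w i₀) - Real.log (w i) := by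
    refine tendsto_nhds_unique ((Φ.continuous_of_finiteDimensional.tendsto p).comp hglim) ?_
    refine hΦlim.congr fun n => ?_
    simp [hΦg]
  refine ⟨A, hA, p, ?_, ?_⟩
  · have hev : ∀ i, i ∉ A → ∀ᶠ n in atTop,
        c i₀ (x n - g (Φ (x n))) < c i (x n - g (Φ (x n))) := by
      intro i hi
      have hwi : w i = 0 := le_antisymm (not_lt.1 fun h => hi ((hmem i).1 h)) (w.2.1 i)
      have h1 : Tendsto (fun n => c i (x n) - c i₀ (x n)) atTop atTop := by
        simp_rw [hlog, sub_eq_add_neg]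
        refine hlog₀.add_atTop (tendsto_neg_atBot_atTop.comp ?_)
        refine Real.tendsto_log_nhdsNE_zero.comp (tendsto_nhdsWithin_iff.2 ⟨?_, ?_⟩)
        · rw [← hwi]
          exact hlim i
        · exact Eventually.of_forall fun n => (gibbs_pos (Finset.mem_univ i)).ne'
      have h2 : Tendsto (fun n => (c i₀ - c i) (g (Φ (x n)))) atTop (𝓝 ((c i₀ - c i) p)) :=
        ((c i₀ - c i).continuous.tendsto p).comp hglim
      filter_upwards [(h1.atTop_add h2).eventually_gt_atTop 0] with n hn
      simp only [map_sub, sub_apply] at hn ⊢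
      linarith
    obtain ⟨n, hn⟩ := (eventually_all.2 fun i => eventually_imp_distrib_left.2 (hev i)).exists
    refine ⟨x n - g (Φ (x n)), c i₀ (x n - g (Φ (x n))), fun i hi => ?_, hn⟩
    have h1 := congrFun (hΦg (x n)) ⟨i, hi⟩
    rw [hΦ, hΦ] at h1
    simp only [map_sub]
    linarith
  · exact eq_gibbs_of_log_sub_log h₀ hmem fun i hi => (congrFun hΦp ⟨i, hi⟩).symm

/-- The Gibbs weights determine the differences `⟨cᵢ - cⱼ | x⟩`, hence `x`. -/
theorem isEmbedding_gibbsUniv [FiniteDimensional ℝ X] [Nonempty ι]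
    (hc : ∀ x : X, (∀ i j, c i x = c j x) → x = 0) : IsEmbedding (gibbsUniv c) := by
  let G : X → {w : stdSimplex ℝ ι | ∀ i, 0 < w i} :=
    fun x => ⟨gibbsUniv c x, fun i => gibbs_pos (Finset.mem_univ i)⟩
  let H : {w : stdSimplex ℝ ι | ∀ i, 0 < w i} → (ι × ι → ℝ) :=
    fun w ij => Real.log (w.1 ij.1) - Real.log (w.1 ij.2)
  let K : X →ₗ[ℝ] (ι × ι → ℝ) :=
    LinearMap.pi fun ij => ((c ij.2 - c ij.1 : StrongDual ℝ X) : X →ₗ[ℝ] ℝ)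
  have hGc : Continuous G := continuous_gibbs.subtype_mk _
  have hHc : Continuous H := by
    have hcoord : ∀ i, Continuous fun w : {w : stdSimplex ℝ ι | ∀ i, 0 < w i} =>
        Real.log (w.1 i) := fun i =>
      Continuous.log (((continuous_apply i).comp continuous_subtype_val).comp
        continuous_subtype_val) fun w => (w.2 i).ne'
    exact continuous_pi fun ij => (hcoord ij.1).sub (hcoord ij.2)
  have hHG : H ∘ G = K := by
    ext x ij
    change Real.log (gibbsUniv c x ij.1) - Real.log (gibbsUniv c x ij.2) = c ij.2 x - c ij.1 x
    rw [log_gibbs (Finset.mem_univ _), log_gibbs (Finset.mem_univ _)]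
    ring
  have hK : LinearMap.ker K = ⊥ := by
    refine LinearMap.ker_eq_bot'.2 fun x hx => hc x fun i j => ?_
    exact sub_eq_zero.1 (congrFun hx (j, i))
  have hemb : IsEmbedding (H ∘ G) := hHG ▸ (K.isClosedEmbedding_of_injective hK).isEmbedding
  exact IsEmbedding.subtypeVal.comp (IsEmbedding.of_comp hGc hHc hemb)

/-! ### Barycenters of Gibbs weights -/

/-- The barycenter of the points `cᵢ` with weights `w`. -/
def barycenter (c : ι → StrongDual ℝ X) (w : stdSimplex ℝ ι) : StrongDual ℝ X :=
  ∑ i, w i • c i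

theorem barycenter_apply (w : stdSimplex ℝ ι) (x : X) : barycenter c w x = ∑ i, w i * c i x := by
  simp [barycenter]

theorem continuous_barycenter : Continuous (barycenter c) := by
  refine continuous_finsetSum _ fun i _ => ?_
  have h : Continuous fun w : stdSimplex ℝ ι => w i :=
    (continuous_apply i).comp continuous_subtype_val
  exact h.smul continuous_const

theorem barycenter_mem_convexHull (w : stdSimplex ℝ ι) :
    barycenter c w ∈ convexHull ℝ (range c) := by
  refine (convex_convexHull ℝ _).sum_mem (fun i _ => w.2.1 i) w.2.2 fun i _ => ?_
  exact subset_convexHull ℝ _ (mem_range_self i)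

/-- Weights `w` with the same barycenter as Gibbs weights on a face are supported in the vertices of
the face. -/
theorem support_subset_of_barycenter_eq (h : IsVertexSetOfFace c A) {w : stdSimplex ℝ ι}
    (hw : barycenter c (gibbs c hA p) = barycenter c w) {i : ι} (hi : 0 < w i) : i ∈ A := by
  obtain ⟨u, a, hu, hu'⟩ := h
  by_contra hiA
  have h1 : ∑ i, gibbs c hA p i * (c i u - a) = 0 := by
    refine Finset.sum_eq_zero fun j _ => ?_
    by_cases hj : j ∈ A
    · rw [hu j hj, sub_self, mul_zero]
    · rw [gibbs_apply_of_notMem hj, zero_mul]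
  have h2 : ∑ i, w i * (c i u - a) = ∑ i, gibbs c hA p i * (c i u - a) := by
    have hs : ∑ i, w i = ∑ i, gibbs c hA p i := w.2.2.trans (gibbs c hA p).2.2.symm
    simp_rw [mul_sub, Finset.sum_sub_distrib, ← barycenter_apply, ← Finset.sum_mul, hw, hs]
  have h3 : 0 < ∑ i, w i * (c i u - a) := by
    refine Finset.sum_pos' (fun j _ => mul_nonneg (w.2.1 j) ?_)
      ⟨i, Finset.mem_univ i, mul_pos hi (sub_pos.2 (hu' i hiA))⟩
    by_cases hj : j ∈ A
    · rw [hu j hj, sub_self]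
    · exact (sub_pos.2 (hu' j hj)).le
  exact h3.ne' (h2.trans h1)

/-- Monotonicity of the logarithm makes every term of `∑ (wᵢ - wᵢ') (log wᵢ - log wᵢ')`
nonnegative. For Gibbs weights on the same set with equal barycenters the sum vanishes. -/
theorem gibbs_eq_of_barycenter_eq (h : IsVertexSetOfFace c A) (h' : IsVertexSetOfFace c A')
    (hw : barycenter c (gibbs c hA p) = barycenter c (gibbs c hA' p')) :
    gibbs c hA p = gibbs c hA' p' := by
  obtain rfl : A = A' := by
    ext i
    exact ⟨fun hi => support_subset_of_barycenter_eq h' hw.symm (gibbs_pos hi),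
      fun hi => support_subset_of_barycenter_eq h hw (gibbs_pos hi)⟩
  set w := gibbs c hA p with hwdef
  set w' := gibbs c hA p' with hwdef'
  set b := Real.log (∑ j ∈ A, Real.exp (-(c j p))) - Real.log (∑ j ∈ A, Real.exp (-(c j p')))
    with hb
  have hterm : ∀ i, (w i - w' i) * (Real.log (w i) - Real.log (w' i)) =
      w i * (c i (p' - p) - b) - w' i * (c i (p' - p) - b) := by
    intro i
    by_cases hi : i ∈ A
    · rw [hwdef, hwdef', log_gibbs hi, log_gibbs hi, hb, map_sub]
      ring
    · rw [hwdef, hwdef', gibbs_apply_of_notMem hi, gibbs_apply_of_notMem hi]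
      ring
  have hsum : ∑ i, (w i - w' i) * (Real.log (w i) - Real.log (w' i)) = 0 := by
    have hs : ∑ i, w i = ∑ i, w' i := w.2.2.trans w'.2.2.symm
    simp_rw [hterm, mul_sub, Finset.sum_sub_distrib, ← barycenter_apply, ← Finset.sum_mul, hw, hs]
    ring
  have hnonneg : ∀ i, 0 ≤ (w i - w' i) * (Real.log (w i) - Real.log (w' i)) := by
    intro i
    by_cases hi : i ∈ A
    · have h1 : 0 < w i := gibbs_pos hi
      have h2 : 0 < w' i := gibbs_pos hi
      rcases le_total (w i) (w' i) with hle | hle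
      · exact mul_nonneg_of_nonpos_of_nonpos (sub_nonpos.2 hle)
          (sub_nonpos.2 (Real.log_le_log h1 hle))
      · exact mul_nonneg (sub_nonneg.2 hle) (sub_nonneg.2 (Real.log_le_log h2 hle))
    · rw [hwdef, hwdef', gibbs_apply_of_notMem hi, gibbs_apply_of_notMem hi]
      simp
  have hzero := (Finset.sum_eq_zero_iff_of_nonneg fun i _ => hnonneg i).1 hsum
  ext i
  by_cases hi : i ∈ A
  · have h1 : 0 < w i := gibbs_pos hi
    have h2 : 0 < w' i := gibbs_pos hi
    rcases mul_eq_zero.1 (hzero i (Finset.mem_univ i)) with h3 | h3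
    · exact sub_eq_zero.1 h3
    · exact Real.log_injOn_pos h1 h2 (sub_eq_zero.1 h3)
  · rw [hwdef, hwdef', gibbs_apply_of_notMem hi, gibbs_apply_of_notMem hi]

theorem injOn_barycenter [FiniteDimensional ℝ X] [Nonempty ι] :
    InjOn (barycenter c) (closure (range (gibbsUniv c))) := by
  intro w hw w' hw' h
  obtain ⟨A, hA, p, hface, rfl⟩ := exists_eq_gibbs_of_mem_closure hw
  obtain ⟨A', hA', p', hface', rfl⟩ := exists_eq_gibbs_of_mem_closure hw'
  exact gibbs_eq_of_barycenter_eq hface hface' h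

/-- A point `q` is a barycenter with Gibbs weights if `x ↦ log (∑ exp (-⟨cᵢ | x⟩)) + ⟨q | x⟩` is
coercive: the weights at a minimum of this function have barycenter `q`, since the derivative
vanishes there. -/
theorem exists_barycenter_gibbsUniv_eq [FiniteDimensional ℝ X] [Nonempty ι]
    {q : StrongDual ℝ X} {ε : ℝ} (hε : 0 < ε) (hq : ∀ x, ∃ i, ε * ‖x‖ ≤ q x - c i x) :
    ∃ x, barycenter c (gibbsUniv c x) = q := by
  have hZ : ∀ x : X, 0 < ∑ j, Real.exp (-(c j x)) := fun x =>
    Finset.sum_pos (fun i _ => Real.exp_pos _) Finset.univ_nonempty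
  let f : X → ℝ := fun x => Real.log (∑ j, Real.exp (-(c j x))) + q x
  have hf : Continuous f :=
    (Continuous.log (by fun_prop) fun x => (hZ x).ne').add q.continuous
  have hge : ∀ x, ε * ‖x‖ ≤ f x := by
    intro x
    obtain ⟨i, hi⟩ := hq x
    have h1 : Real.exp (-(c i x)) ≤ ∑ j, Real.exp (-(c j x)) :=
      Finset.single_le_sum (f := fun j => Real.exp (-(c j x)))
        (fun j _ => (Real.exp_pos _).le) (Finset.mem_univ i)
    have h2 := (Real.le_log_iff_exp_le (hZ x)).2 h1
    simp only [f]
    linarith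
  have : ProperSpace X := FiniteDimensional.proper ℝ X
  have hlim : Tendsto f (cocompact X) atTop :=
    tendsto_atTop_mono hge ((tendsto_norm_cocompact_atTop (E := X)).const_mul_atTop hε)
  obtain ⟨x, hx⟩ := hf.exists_forall_le hlim
  refine ⟨x, ?_⟩
  have hd : HasFDerivAt f ((∑ j, Real.exp (-(c j x)))⁻¹ • (∑ j, Real.exp (-(c j x)) • -(c j)) + q)
      x :=
    ((HasFDerivAt.fun_sum fun j _ => (c j).hasFDerivAt.neg.exp).log (hZ x).ne').add q.hasFDerivAt
  have hmin : IsLocalMin f x := Eventually.of_forall hx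
  have h0 := hmin.hasFDerivAt_eq_zero hd
  rw [barycenter, sum_gibbs_smul, ← sub_eq_zero, ← neg_eq_zero, ← h0, Finset.smul_sum]
  simp only [smul_neg, Finset.sum_neg_distrib, smul_smul, div_eq_inv_mul]
  abel

theorem momentMap_eq_barycenter_gibbs (hinj : Function.Injective c) {C : Set (StrongDual ℝ X)}
    (hC : C.extremePoints ℝ = c '' A) : momentMap C p = barycenter c (gibbs c hA p) := by
  rw [momentMap, hC, barycenter, sum_gibbs_smul,
    finsum_mem_image hinj.injOn, finsum_mem_image hinj.injOn,
    finsum_mem_coe_finset, finsum_mem_coe_finset]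

/-! ### Max-plus functions attached to weights -/

/-- The function `y ↦ log (maxᵢ wᵢ exp ⟨cᵢ | y⟩) = maxᵢ (log wᵢ + ⟨cᵢ | y⟩)`. The exponential form
allows zero weights, for which `log wᵢ` stands for `-∞`. -/
def maxPlus [Nonempty ι] (c : ι → StrongDual ℝ X) (w : stdSimplex ℝ ι) (y : X) : ℝ :=
  Real.log (Finset.univ.sup' Finset.univ_nonempty fun i => w i * Real.exp (c i y))

section

variable [Nonempty ι]

theorem sup'_weight_mul_exp_pos (w : stdSimplex ℝ ι) (y : X) :
    0 < Finset.univ.sup' Finset.univ_nonempty fun i => w i * Real.exp (c i y) := by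
  obtain ⟨i, -, hi⟩ : ∃ i ∈ Finset.univ, 0 < w i := by
    refine Finset.exists_lt_of_sum_lt (f := fun _ => (0 : ℝ)) ?_
    rw [Finset.sum_const_zero]
    exact w.2.2.symm ▸ one_pos
  exact (mul_pos hi (Real.exp_pos _)).trans_le
    (Finset.le_sup' (fun i => w i * Real.exp (c i y)) (Finset.mem_univ i))

theorem continuous_maxPlus :
    Continuous fun wy : stdSimplex ℝ ι × X => maxPlus c wy.1 wy.2 := by
  refine Continuous.log ?_ fun wy => (sup'_weight_mul_exp_pos wy.1 wy.2).ne'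
  refine Continuous.finset_sup'_apply _ fun i _ => Continuous.mul ?_ (by fun_prop)
  exact ((continuous_apply i).comp continuous_subtype_val).comp continuous_fst

/-- The class of `maxPlus c w` modulo constants. -/
def maxPlusClass (c : ι → StrongDual ℝ X) (w : stdSimplex ℝ ι) : FunctionsModConstants X :=
  Submodule.Quotient.mk
    (ContinuousMap.curry ⟨fun wy : stdSimplex ℝ ι × X => maxPlus c wy.1 wy.2, continuous_maxPlus⟩ w)

theorem continuous_maxPlusClass : Continuous (maxPlusClass c) := by
  refine Continuous.comp (g := Submodule.Quotient.mk) ?_ (map_continuous (ContinuousMap.curry _))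
  exact continuous_quot_mk

/-- Along a ray that exposes `cᵢ`, the weight `wᵢ` is read off from the asymptotics of
`maxPlus c w`. -/
theorem tendsto_exp_maxPlus (w : stdSimplex ℝ ι) {i : ι} {u : X}
    (hu : ∀ j, j ≠ i → c j u < c i u) :
    Tendsto (fun t : ℝ => Real.exp (maxPlus c w (t • u) - t * c i u)) atTop (𝓝 (w i)) := by
  classical
  have h1 : ∀ t : ℝ, Real.exp (maxPlus c w (t • u) - t * c i u) =
      Finset.univ.sup' Finset.univ_nonempty fun j => w j * Real.exp (-(t * (c i u - c j u))) := by
    intro t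
    rw [Real.exp_sub, maxPlus, Real.exp_log (sup'_weight_mul_exp_pos w _), div_eq_mul_inv,
      Finset.sup'_mul₀ (inv_nonneg.2 (Real.exp_pos _).le)]
    refine Finset.sup'_congr _ rfl fun j _ => ?_
    rw [mul_assoc, ← Real.exp_neg, ← Real.exp_add]
    simp only [map_smul, smul_eq_mul]
    ring_nf
  simp_rw [h1]
  have h2 : w i = Finset.univ.sup' Finset.univ_nonempty fun j => if j = i then w j else 0 := by
    refine le_antisymm ?_ (Finset.sup'_le _ _ fun j _ => ?_)
    · exact (if_pos rfl).ge.trans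
        (Finset.le_sup' (fun j => if j = i then w j else 0) (Finset.mem_univ i))
    · split_ifs with hj
      · rw [hj]
      · exact w.2.1 i
  rw [h2]
  refine Tendsto.finset_sup'_nhds_apply _ fun j _ => ?_
  split_ifs with hj
  · simp [hj]
  · rw [← mul_zero (w j)]
    refine Tendsto.const_mul _ (Real.tendsto_exp_atBot.comp (tendsto_neg_atTop_atBot.comp ?_))
    exact tendsto_id.atTop_mul_const (sub_pos.2 (hu j hj))

theorem injective_maxPlusClass (hc : ∀ i, ∃ u, ∀ j, j ≠ i → c j u < c i u) :
    Function.Injective (maxPlusClass c) := by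
  intro w w' h
  obtain ⟨b, hb⟩ := mk_functionsModConstants_eq_iff.1 h
  have hb' : ∀ y, maxPlus c w y = b + maxPlus c w' y := fun y => sub_eq_iff_eq_add.1 (hb y)
  have key : ∀ i, w i = Real.exp b * w' i := by
    intro i
    obtain ⟨u, hu⟩ := hc i
    refine tendsto_nhds_unique (tendsto_exp_maxPlus w hu) ?_
    refine ((tendsto_exp_maxPlus w' hu).const_mul (Real.exp b)).congr fun t => ?_
    rw [← Real.exp_add, hb', add_sub_assoc]
  have h1 : Real.exp b = 1 := by
    have h2 : ∑ i, w i = 1 := w.2.2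
    have h3 : ∑ i, w' i = 1 := w'.2.2
    rwa [Finset.sum_congr rfl fun i _ => key i, ← Finset.mul_sum, h3, mul_one] at h2
  ext i
  rw [key, h1, one_mul]

theorem isClosedEmbedding_maxPlusClass (hc : ∀ i, ∃ u, ∀ j, j ≠ i → c j u < c i u) :
    IsClosedEmbedding (maxPlusClass c) := by
  have : IsClosed (constantFunctions X : Set C(X, ℝ)) := isClosed_constantFunctions
  exact continuous_maxPlusClass.isClosedEmbedding (injective_maxPlusClass hc)

theorem maxPlus_gibbs (y : X) : maxPlus c (gibbs c hA p) y =
    pseudoNorm (convexHull ℝ (c '' A)) (p - y) - Real.log (∑ j ∈ A, Real.exp (-(c j p))) := by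
  set Z := ∑ j ∈ A, Real.exp (-(c j p)) with hZdef
  have hZ : 0 < Z := Finset.sum_pos (fun i _ => Real.exp_pos _) hA
  obtain ⟨⟨i, hi, hmax⟩, hub⟩ := isGreatest_pseudoNorm_convexHull (c := c) hA (p - y)
  have hval : ∀ j ∈ A, gibbs c hA p j * Real.exp (c j y) = Real.exp (-(c j (p - y))) / Z := by
    intro j hj
    rw [gibbs_apply_of_mem hj, div_mul_eq_mul_div, ← Real.exp_add, map_sub, neg_sub,
      neg_add_eq_sub]
  have hsup : (Finset.univ.sup' Finset.univ_nonempty fun i =>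
      gibbs c hA p i * Real.exp (c i y)) =
      Real.exp (pseudoNorm (convexHull ℝ (c '' A)) (p - y)) / Z := by
    refine le_antisymm (Finset.sup'_le _ _ fun j _ => ?_) ?_
    · by_cases hj : j ∈ A
      · rw [hval j hj]
        gcongr
        exact hub ⟨j, hj, rfl⟩
      · rw [gibbs_apply_of_notMem hj, zero_mul]
        positivity
    · rw [← hmax]
      exact (hval i hi).ge.trans
        (Finset.le_sup' (fun i => gibbs c hA p i * Real.exp (c i y)) (Finset.mem_univ i))
  rw [maxPlus, hsup, Real.log_div (Real.exp_pos _).ne' hZ.ne', Real.log_exp]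

/-- The functions `h_{E,p}` are the max-plus functions of Gibbs weights, up to a constant. -/
theorem maxPlusClass_gibbs {E : Set (StrongDual ℝ X)} (hE : E = convexHull ℝ (c '' A)) {f : C(X, ℝ)}
    (hf : ∀ y, f y = pseudoNorm E (p - y) - pseudoNorm E p) :
    maxPlusClass c (gibbs c hA p) = Submodule.Quotient.mk f := by
  refine mk_functionsModConstants_eq_iff.2
    ⟨pseudoNorm E p - Real.log (∑ j ∈ A, Real.exp (-(c j p))), fun y => ?_⟩
  rw [hf, hE]
  change maxPlus c _ y - _ = _
  rw [maxPlus_gibbs]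
  ring

end

end Gibbs

/-! ### The norm as support function of the dual unit ball -/

namespace PolyhedralNorm

variable {X : Type*} [NormedAddCommGroup X] [InnerProductSpace ℝ X] (N : PolyhedralNorm X)

theorem map_zero : N 0 = 0 := by simpa using N.smul_of_nonneg 0 0 le_rfl

theorem nonneg (x : X) : 0 ≤ N x := by
  rcases eq_or_ne x 0 with rfl | hx
  · exact N.map_zero.ge
  · exact (N.pos_of_ne_zero x hx).le

theorem inv_smul_mem_unitBall {x : X} (hx : x ≠ 0) : (N x)⁻¹ • x ∈ N.unitBall := by
  have h := N.pos_of_ne_zero x hx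
  change N _ ≤ 1
  rw [N.smul_of_nonneg _ _ (inv_nonneg.2 h.le), inv_mul_cancel₀ h.ne']

theorem exists_norm_le_mul : ∃ R, 0 < R ∧ ∀ x, ‖x‖ ≤ R * N x := by
  obtain ⟨S, hS⟩ := N.polyhedral
  have hb : Bornology.IsBounded N.unitBall := by
    rw [unitBall, hS, isBounded_convexHull]
    exact S.finite_toSet.isBounded
  obtain ⟨R, hR, hBR⟩ := hb.exists_pos_norm_le
  refine ⟨R, hR, fun x => ?_⟩
  rcases eq_or_ne x 0 with rfl | hx
  · simp [N.map_zero]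
  · have h := N.pos_of_ne_zero x hx
    have h1 := hBR _ (N.inv_smul_mem_unitBall hx)
    rw [norm_smul, Real.norm_of_nonneg (inv_nonneg.2 h.le), inv_mul_le_iff₀ h] at h1
    linarith

variable {N} in
theorem neg_le_of_mem_dualUnitBall {q : StrongDual ℝ X} (hq : q ∈ N.dualUnitBall) (x : X) :
    -N x ≤ q x := by
  rcases eq_or_ne x 0 with rfl | hx
  · simp [N.map_zero]
  · have h := N.pos_of_ne_zero x hx
    have h1 := hq _ (N.inv_smul_mem_unitBall hx)
    rw [map_smul, smul_eq_mul, inv_mul_eq_div, le_div_iff₀ h] at h1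
    linarith

theorem exists_mem_dualUnitBall_eq_neg [FiniteDimensional ℝ X] (x : X) :
    ∃ q ∈ N.dualUnitBall, q x = -N x := by
  rcases eq_or_ne x 0 with rfl | hx
  · exact ⟨0, fun y _ => by simp, by simp [N.map_zero]⟩
  have hspan : ∀ (t : ℝ) (ht : t • x ∈ (LinearPMap.mkSpanSingleton (K := ℝ) x (N x) hx).domain),
      LinearPMap.mkSpanSingleton (K := ℝ) x (N x) hx ⟨t • x, ht⟩ = t * N x :=
    fun t ht => LinearPMap.mkSpanSingleton'_apply (σ := RingHom.id ℝ) x (N x) _ t ht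
  obtain ⟨g, hg, hgN⟩ := exists_extension_of_le_sublinear
    (LinearPMap.mkSpanSingleton (K := ℝ) x (N x) hx) N
    (fun t ht y => N.smul_of_nonneg t y ht.le) N.add_le (by
      rintro ⟨y, hy⟩
      obtain ⟨t, rfl⟩ := Submodule.mem_span_singleton.1 hy
      rw [hspan]
      rcases le_total 0 t with ht | ht
      · exact (N.smul_of_nonneg t x ht).ge
      · exact (mul_nonpos_of_nonpos_of_nonneg ht (N.nonneg x)).trans (N.nonneg _))
  refine ⟨-LinearMap.toContinuousLinearMap g, fun y hy => ?_, ?_⟩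
  · exact neg_le_neg ((hgN y).trans hy)
  · have h1 : g ((1 : ℝ) • x) = 1 * N x :=
      (hg ⟨_, Submodule.smul_mem _ _ (Submodule.mem_span_singleton_self x)⟩).trans (hspan 1 _)
    rw [one_mul, one_smul] at h1
    exact congrArg Neg.neg h1

theorem isLeast_apply_image_dualUnitBall [FiniteDimensional ℝ X] (x : X) :
    IsLeast ((fun q : StrongDual ℝ X => q x) '' N.dualUnitBall) (-N x) := by
  obtain ⟨q, hq, hqx⟩ := N.exists_mem_dualUnitBall_eq_neg x
  refine ⟨⟨q, hq, hqx⟩, ?_⟩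
  rintro _ ⟨r, hr, rfl⟩
  exact neg_le_of_mem_dualUnitBall hr x

/-- The norm is the support function of the dual unit ball. -/
theorem pseudoNorm_dualUnitBall [FiniteDimensional ℝ X] (x : X) :
    pseudoNorm N.dualUnitBall x = N x := by
  rw [pseudoNorm, (N.isLeast_apply_image_dualUnitBall x).csInf_eq, neg_neg]

theorem convex_dualUnitBall : Convex ℝ N.dualUnitBall := by
  have : N.dualUnitBall = ⋂ x ∈ N.unitBall, {y : StrongDual ℝ X | -1 ≤ y x} := by
    ext y; simp [dualUnitBall]
  rw [this]
  exact convex_iInter₂ fun x _ => convex_halfSpace_ge ⟨fun _ _ => rfl, fun _ _ => rfl⟩ _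

/-! ### Vertices of the dual unit ball -/

theorem exists_finset_dualUnitBall_eq :
    ∃ S : Finset X, N.dualUnitBall = {y | ∀ s ∈ S, -1 ≤ y s} := by
  obtain ⟨S, hS⟩ := N.polyhedral
  refine ⟨S, Subset.antisymm (fun y hy s hs => ?_) fun y hy x hx => ?_⟩
  · exact hy s (hS.ge (subset_convexHull ℝ _ hs))
  · have hconv : Convex ℝ {x : X | -1 ≤ y x} := convex_halfSpace_ge y.isLinear _
    exact convexHull_min hy hconv (hS.le hx)

/-- A vertex of a polyhedron given by finitely many inequalities `-1 ≤ ⟨y | s⟩` is the only point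
at which the inequalities that are tight at this vertex are tight. -/
theorem eq_of_forall_tight {S : Finset X} {y y' : StrongDual ℝ X}
    (hy : y ∈ {y : StrongDual ℝ X | ∀ s ∈ S, -1 ≤ y s}.extremePoints ℝ)
    (hy' : ∀ s ∈ S, -1 ≤ y' s) (h : ∀ s ∈ S, y s = -1 → y' s = -1) : y' = y := by
  -- The segment from `y'` to `y` can be prolonged beyond `y`.
  have hev : ∀ᶠ ε : ℝ in 𝓝[>] 0, ∀ s ∈ S, -1 ≤ y s - ε * (y' s - y s) := by
    rw [eventually_all_finset]
    intro s hs
    by_cases hs1 : y s = -1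
    · refine Eventually.of_forall fun ε => ?_
      rw [h s hs hs1, hs1]
      simp
    · have h1 : Tendsto (fun ε : ℝ => y s - ε * (y' s - y s)) (𝓝 0) (𝓝 (y s)) :=
        Continuous.tendsto' (by fun_prop) _ _ (by simp)
      have h2 : -1 < y s := lt_of_le_of_ne (hy.1 s hs) (Ne.symm hs1)
      exact (h1.mono_left nhdsWithin_le_nhds).eventually_const_le h2
  obtain ⟨ε, hε, hε0⟩ := (hev.and self_mem_nhdsWithin).exists
  replace hε0 : 0 < ε := hε0
  have h3 : y ∈ openSegment ℝ y' (y - ε • (y' - y)) := by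
    refine ⟨ε / (1 + ε), 1 / (1 + ε), by positivity, by positivity, by field_simp; ring, ?_⟩
    ext x
    simp only [add_apply, smul_apply, sub_apply, smul_eq_mul]
    field_simp
    ring
  exact hy.2 hy' (fun s hs => by simpa using hε s hs) h3

theorem finite_extremePoints : (N.dualUnitBall.extremePoints ℝ).Finite := by
  classical
  obtain ⟨S, hS⟩ := N.exists_finset_dualUnitBall_eq
  rw [hS]
  refine Finite.of_injOn (f := fun y : StrongDual ℝ X => S.filter fun s => y s = -1)
    (t := (S.powerset : Set (Finset X))) (fun y _ => ?_) (fun y hy y' hy' h => ?_)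
    (Finset.finite_toSet _)
  · exact Finset.mem_coe.2 (Finset.mem_powerset.2 (Finset.filter_subset _ _))
  · refine (eq_of_forall_tight hy hy'.1 fun s hs hys => ?_).symm
    exact (Finset.mem_filter.1 ((Finset.ext_iff.1 h s).1 (Finset.mem_filter.2 ⟨hs, hys⟩))).2

/-- Every vertex of `B°` is exposed: minus the sum of the constraints tight at the vertex is
maximal at the vertex only. -/
theorem exists_exposing_of_mem_extremePoints {y : StrongDual ℝ X}
    (hy : y ∈ N.dualUnitBall.extremePoints ℝ) :
    ∃ u, ∀ y' ∈ N.dualUnitBall, y' ≠ y → y' u < y u := by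
  classical
  obtain ⟨S, hS⟩ := N.exists_finset_dualUnitBall_eq
  rw [hS] at hy ⊢
  refine ⟨-∑ s ∈ S.filter fun s => y s = -1, s, fun y' hy' hne => ?_⟩
  rw [map_neg, map_neg, neg_lt_neg_iff, map_sum, map_sum]
  have h1 : ∀ s ∈ S.filter (fun s => y s = -1), y s ≤ y' s := by
    intro s hs
    rw [(Finset.mem_filter.1 hs).2]
    exact hy' s (Finset.mem_filter.1 hs).1
  refine Finset.sum_lt_sum h1 ?_
  by_contra! h2
  refine hne (eq_of_forall_tight hy hy' fun s hs hys => ?_)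
  have hs' : s ∈ S.filter fun s => y s = -1 := Finset.mem_filter.2 ⟨hs, hys⟩
  rw [← hys]
  exact le_antisymm (h2 s hs') (h1 s hs')

/-- The vertices of the dual unit ball. -/
abbrev Vertex : Type _ := N.dualUnitBall.extremePoints ℝ

/-- The inclusion of the vertices of `B°` into the dual space. -/
abbrev vertex (v : N.Vertex) : StrongDual ℝ X := v.1

variable {N} in
theorem extremePoints_eq_inter {E : Set (StrongDual ℝ X)} (hE : IsExposed ℝ N.dualUnitBall E) :
    E.extremePoints ℝ = E ∩ N.dualUnitBall.extremePoints ℝ :=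
  hE.isExtreme.extremePoints_eq

instance : Fintype N.Vertex := N.finite_extremePoints.fintype

open scoped Classical in
/-- The vertices of `B°` that lie in `E`. -/
def verticesIn (N : PolyhedralNorm X) (E : Set (StrongDual ℝ X)) : Finset N.Vertex :=
  Finset.univ.filter fun v => v.1 ∈ E

variable {N}

theorem mem_verticesIn {E : Set (StrongDual ℝ X)} {v : N.Vertex} :
    v ∈ N.verticesIn E ↔ v.1 ∈ E := by
  simp [verticesIn]

theorem extremePoints_eq_image {E : Set (StrongDual ℝ X)} (hE : IsExposed ℝ N.dualUnitBall E) :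
    E.extremePoints ℝ = N.vertex '' N.verticesIn E := by
  rw [extremePoints_eq_inter hE]
  ext q
  constructor
  · rintro ⟨h1, h2⟩
    exact ⟨⟨q, h2⟩, mem_verticesIn.2 h1, rfl⟩
  · rintro ⟨v, hv, rfl⟩
    exact ⟨mem_verticesIn.1 hv, v.2⟩

theorem verticesIn_dualUnitBall : N.verticesIn N.dualUnitBall = Finset.univ :=
  Finset.eq_univ_iff_forall.2 fun v => mem_verticesIn.2 v.2.1

/-- The vertices of a face `E` agree on the span of the dual face `E°`. -/
theorem ProperDualFace.apply_eq_apply_of_mem_span (E : N.ProperDualFace) {e e' : StrongDual ℝ X}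
    (he : e ∈ E.carrier) (he' : e' ∈ E.carrier) {k : X}
    (hk : k ∈ Submodule.span ℝ E.dualFace) : e k = e' k := by
  have h : Submodule.span ℝ E.dualFace ≤ LinearMap.ker ((e - e' : StrongDual ℝ X) : X →ₗ[ℝ] ℝ) := by
    refine Submodule.span_le.2 fun x hx => ?_
    change e x - e' x = 0
    rw [hx.2 e he, hx.2 e' he', sub_self]
  exact sub_eq_zero.1 (h hk)

variable [FiniteDimensional ℝ X]

instance : Nonempty N.Vertex :=
  (N.isCompact_dualUnitBall.extremePoints_nonempty ⟨0, fun x _ => by simp⟩).to_subtype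

/-! ### Faces of the dual unit ball -/

/-- Faces of `B°` are spanned by their vertices. -/
theorem eq_convexHull_extremePoints {E : Set (StrongDual ℝ X)}
    (hE : IsExposed ℝ N.dualUnitBall E) : E = convexHull ℝ (E.extremePoints ℝ) := by
  have hfin : (E.extremePoints ℝ).Finite := by
    rw [extremePoints_eq_inter hE]
    exact N.finite_extremePoints.subset inter_subset_right
  rw [← (hfin.isClosed_convexHull ℝ).closure_eq]
  exact (closure_convexHull_extremePoints (hE.isCompact N.isCompact_dualUnitBall)
    (hE.convex N.convex_dualUnitBall)).symm

theorem eq_convexHull_image {E : Set (StrongDual ℝ X)} (hE : IsExposed ℝ N.dualUnitBall E) :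
    E = convexHull ℝ (N.vertex '' N.verticesIn E) := by
  rw [← extremePoints_eq_image hE]
  exact eq_convexHull_extremePoints hE

theorem verticesIn_nonempty {E : Set (StrongDual ℝ X)} (hE : IsExposed ℝ N.dualUnitBall E)
    (hne : E.Nonempty) : (N.verticesIn E).Nonempty := by
  have h := (hE.isCompact N.isCompact_dualUnitBall).extremePoints_nonempty hne
  rw [extremePoints_eq_image hE] at h
  simpa using h

theorem dualUnitBall_eq_convexHull : N.dualUnitBall = convexHull ℝ (range N.vertex) := by
  rw [Subtype.range_coe]
  exact eq_convexHull_extremePoints (IsExposed.refl N.dualUnitBall)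

/-- Linear functionals on the dual space are evaluations at points of `X`, so an exposed face is the
set of minimizers of an evaluation. -/
theorem isVertexSetOfFace_verticesIn {E : Set (StrongDual ℝ X)}
    (hE : IsExposed ℝ N.dualUnitBall E) (hne : E.Nonempty) :
    IsVertexSetOfFace N.vertex (N.verticesIn E) := by
  obtain ⟨l, hl⟩ := hE hne
  obtain ⟨u, hu⟩ : ∃ u : X, ∀ q : StrongDual ℝ X, q u = -l q := by
    refine ⟨-(InnerProductSpace.toDual ℝ X).symm
      (l.comp (InnerProductSpace.toDual ℝ X).toContinuousLinearEquiv.toContinuousLinearMap), ?_⟩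
    intro q
    obtain ⟨x, rfl⟩ := (InnerProductSpace.toDual ℝ X).surjective q
    rw [InnerProductSpace.toDual_apply_apply, inner_neg_right, real_inner_comm,
      InnerProductSpace.toDual_symm_apply]
    rfl
  obtain ⟨e, he⟩ := id hne
  have he' := hl ▸ he
  refine ⟨u, e u, fun v hv => ?_, fun v hv => ?_⟩
  · have h1 := hl ▸ mem_verticesIn.1 hv
    rw [hu, hu, neg_inj]
    exact le_antisymm (he'.2 _ h1.1) (h1.2 _ he'.1)
  · rw [hu, hu, neg_lt_neg_iff]
    by_contra! h1
    refine hv (mem_verticesIn.2 ?_)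
    rw [hl]
    exact ⟨v.2.1, fun r hr => (he'.2 r hr).trans h1⟩

/-- Conversely, every vertex set of a face other than the whole set of vertices comes from a proper
face of `B°`. -/
theorem exists_properDualFace {A : Finset N.Vertex} (hA : A.Nonempty)
    (hface : IsVertexSetOfFace N.vertex A) (hne : A ≠ Finset.univ) :
    ∃ E : N.ProperDualFace, N.verticesIn E.carrier = A := by
  obtain ⟨u, a, hu, hu'⟩ := hface
  have hle : ∀ q ∈ N.dualUnitBall, a ≤ q u := by
    intro q hq
    rw [dualUnitBall_eq_convexHull] at hq
    have hconv : Convex ℝ {q : StrongDual ℝ X | a ≤ q u} :=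
      convex_halfSpace_ge ⟨fun _ _ => rfl, fun _ _ => rfl⟩ _
    refine convexHull_min ?_ hconv hq
    rintro _ ⟨v, rfl⟩
    by_cases hv : v ∈ A
    · exact (hu v hv).ge
    · exact (hu' v hv).le
  set E : Set (StrongDual ℝ X) := {q ∈ N.dualUnitBall | ∀ r ∈ N.dualUnitBall,
    (-ContinuousLinearMap.apply ℝ ℝ u) r ≤ (-ContinuousLinearMap.apply ℝ ℝ u) q} with hEdef
  have hmem : ∀ v : N.Vertex, v.1 ∈ E ↔ v ∈ A := by
    obtain ⟨w, hw⟩ := hA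
    intro v
    refine ⟨fun hv => ?_, fun hv => ⟨v.2.1, fun r hr => ?_⟩⟩
    · by_contra hvA
      have h1 : v.1 u ≤ w.1 u := neg_le_neg_iff.1 (hv.2 w.1 w.2.1)
      exact absurd (hu' v hvA) (not_lt.2 (h1.trans (hu w hw).le))
    · exact neg_le_neg ((hu v hv).le.trans (hle r hr))
  have hvert : N.verticesIn E = A := by
    ext v
    rw [mem_verticesIn, hmem]
  refine ⟨⟨E, fun _ => ⟨-ContinuousLinearMap.apply ℝ ℝ u, rfl⟩, ?_, fun h => hne ?_⟩, hvert⟩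
  · obtain ⟨w, hw⟩ := hA
    exact ⟨w.1, (hmem w).2 hw⟩
  · rw [← hvert, h, verticesIn_dualUnitBall]

theorem ProperDualFace.verticesIn_ne_univ (E : N.ProperDualFace) :
    N.verticesIn E.carrier ≠ Finset.univ := by
  intro h
  refine E.ne_dualUnitBall ?_
  rw [eq_convexHull_image E.isExposed, h, Finset.coe_univ, image_univ, dualUnitBall_eq_convexHull]

/-- The vertices of `B°` lie in no affine hyperplane. -/
theorem eq_zero_of_vertex_apply_eq {x : X} (hx : ∀ v w : N.Vertex, v.1 x = w.1 x) : x = 0 := by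
  obtain ⟨v⟩ : Nonempty N.Vertex := inferInstance
  have hconst : ∀ q ∈ N.dualUnitBall, q x = v.1 x := by
    intro q hq
    rw [dualUnitBall_eq_convexHull] at hq
    have hconv : Convex ℝ {q : StrongDual ℝ X | q x = v.1 x} :=
      convex_hyperplane ⟨fun _ _ => rfl, fun _ _ => rfl⟩ _
    refine convexHull_min ?_ hconv hq
    rintro _ ⟨w, rfl⟩
    exact hx w v
  -- The origin lies in `B°`, so the constant value is `0`, while its negative is the norm of `x`.
  have h0 := hconst 0 fun y _ => by simp
  obtain ⟨q, hq, hqx⟩ := N.exists_mem_dualUnitBall_eq_neg x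
  have h1 : N x = 0 := by
    rw [hconst q hq, ← h0] at hqx
    simpa using hqx.symm
  by_contra hne
  exact (N.pos_of_ne_zero x hne).ne' h1

theorem exists_vertex_apply_eq (N : PolyhedralNorm X) (x : X) : ∃ v : N.Vertex, v.1 x = -N x := by
  have h := isGreatest_pseudoNorm_convexHull (c := N.vertex) Finset.univ_nonempty x
  rw [Finset.coe_univ, image_univ, image_univ, ← dualUnitBall_eq_convexHull,
    N.pseudoNorm_dualUnitBall] at h
  obtain ⟨v, hv⟩ := h.1
  exact ⟨v, neg_eq_iff_eq_neg.1 hv⟩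

end PolyhedralNorm

/-! ### The horofunction compactification -/

namespace PolyhedralNorm

variable {X : Type*} [NormedAddCommGroup X] [InnerProductSpace ℝ X] [FiniteDimensional ℝ X]
  (N : PolyhedralNorm X)

/-- The distance functions are the max-plus functions of Gibbs weights on all vertices. -/
theorem psi_eq_maxPlusClass : N.psi = maxPlusClass N.vertex ∘ gibbsUniv N.vertex := by
  ext1 z
  refine (maxPlusClass_gibbs (E := N.dualUnitBall) ?_ fun y => ?_).symm
  · rw [Finset.coe_univ, image_univ, dualUnitBall_eq_convexHull]
  · rw [N.pseudoNorm_dualUnitBall, N.pseudoNorm_dualUnitBall]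
    rfl

theorem isClosedEmbedding_maxPlusClass_vertex : IsClosedEmbedding (maxPlusClass N.vertex) := by
  refine isClosedEmbedding_maxPlusClass fun v => ?_
  obtain ⟨u, hu⟩ := N.exists_exposing_of_mem_extremePoints v.2
  exact ⟨u, fun w hw => hu w.1 w.2.1 fun h => hw (Subtype.ext h)⟩

theorem isEmbedding_psi : IsEmbedding N.psi := by
  rw [psi_eq_maxPlusClass]
  exact N.isClosedEmbedding_maxPlusClass_vertex.isEmbedding.comp
    (isEmbedding_gibbsUniv fun x => eq_zero_of_vertex_apply_eq)

theorem horofunctionCompactification_eq_image : N.horofunctionCompactification =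
    maxPlusClass N.vertex '' closure (range (gibbsUniv N.vertex)) := by
  rw [horofunctionCompactification, psi_eq_maxPlusClass, range_comp,
    N.isClosedEmbedding_maxPlusClass_vertex.closure_image_eq]

variable {N}

theorem ProperDualFace.horofunctionClass_eq (E : N.ProperDualFace) (p : X) :
    E.horofunctionClass p = maxPlusClass N.vertex
      (gibbs N.vertex (verticesIn_nonempty E.isExposed E.nonempty) p) :=
  (maxPlusClass_gibbs (eq_convexHull_image E.isExposed) fun _ => rfl).symm

variable (N)

theorem horofunctionBoundary_eq : N.horofunctionBoundary =
    {ξ | ∃ E : N.ProperDualFace, ∃ p ∈ E.parameterSpace, ξ = E.horofunctionClass p} := by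
  rw [horofunctionBoundary, horofunctionCompactification_eq_image, psi_eq_maxPlusClass]
  ext ξ
  constructor
  · rintro ⟨⟨w, hw, rfl⟩, hξ⟩
    obtain ⟨A, hA, p, hface, rfl⟩ := exists_eq_gibbs_of_mem_closure hw
    have hne : A ≠ Finset.univ := by
      rintro rfl
      exact hξ ⟨p, rfl⟩
    obtain ⟨E, rfl⟩ := exists_properDualFace hA hface hne
    obtain ⟨k, hk, p', hp', rfl⟩ :=
      (Submodule.span ℝ E.dualFace).exists_add_mem_mem_orthogonal p
    refine ⟨E, p', hp', ?_⟩
    rw [E.horofunctionClass_eq, gibbs_add_of_forall_eq fun v hv w hw =>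
      E.apply_eq_apply_of_mem_span (mem_verticesIn.1 hv) (mem_verticesIn.1 hw) hk]
  · rintro ⟨E, p, -, rfl⟩
    rw [E.horofunctionClass_eq]
    refine ⟨⟨_, gibbs_mem_closure_range (isVertexSetOfFace_verticesIn E.isExposed E.nonempty), rfl⟩,
      ?_⟩
    rintro ⟨x, hx⟩
    have h := N.isClosedEmbedding_maxPlusClass_vertex.injective hx
    refine E.verticesIn_ne_univ (Finset.eq_univ_iff_forall.2 fun v => ?_)
    rw [← gibbs_pos_iff (c := N.vertex)
      (hA := verticesIn_nonempty E.isExposed E.nonempty) (p := p), ← h]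
    exact gibbs_pos (Finset.mem_univ v)

theorem barycenter_mem_dualUnitBall (w : stdSimplex ℝ N.Vertex) :
    barycenter N.vertex w ∈ N.dualUnitBall :=
  dualUnitBall_eq_convexHull.ge (barycenter_mem_convexHull w)

/-- The points `t q` with `q ∈ B°` and `t < 1` are barycenters with Gibbs weights; the general
case follows by compactness. -/
theorem dualUnitBall_subset_image_barycenter :
    N.dualUnitBall ⊆ barycenter N.vertex '' closure (range (gibbsUniv N.vertex)) := by
  intro q hq
  obtain ⟨R, hR, hRN⟩ := N.exists_norm_le_mul
  have hclosed : IsClosed (barycenter N.vertex '' closure (range (gibbsUniv N.vertex))) :=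
    (isClosed_closure.isCompact.image continuous_barycenter).isClosed
  have hlim : Tendsto (fun t : ℝ => t • q) (𝓝[<] 1) (𝓝 q) := by
    have h : Tendsto (fun t : ℝ => t • q) (𝓝 1) (𝓝 q) :=
      Continuous.tendsto' (by fun_prop) _ _ (one_smul ℝ q)
    exact h.mono_left nhdsWithin_le_nhds
  refine hclosed.mem_of_tendsto hlim ?_
  filter_upwards [Ioo_mem_nhdsLT (zero_lt_one (α := ℝ))] with t ht
  obtain ⟨x, hx⟩ := exists_barycenter_gibbsUniv_eq (c := N.vertex) (q := t • q)
    (div_pos (sub_pos.2 ht.2) hR) fun x => by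
      obtain ⟨v, hv⟩ := N.exists_vertex_apply_eq x
      refine ⟨v, ?_⟩
      have h1 := mul_le_mul_of_nonneg_left (neg_le_of_mem_dualUnitBall hq x) ht.1.le
      have h2 := mul_le_mul_of_nonneg_left (hRN x) (sub_pos.2 ht.2).le
      rw [smul_apply, smul_eq_mul, vertex, hv, div_mul_eq_mul_div, div_le_iff₀ hR]
      nlinarith
  exact ⟨_, subset_closure (mem_range_self x), hx⟩

/-- The barycenter map restricts to a homeomorphism from the closure of the set of Gibbs weights
onto `B°`. -/
def barycenterHomeomorph : closure (range (gibbsUniv N.vertex)) ≃ₜ N.dualUnitBall :=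
  have : CompactSpace (closure (range (gibbsUniv N.vertex))) :=
    isCompact_iff_compactSpace.1 isClosed_closure.isCompact
  Continuous.homeoOfEquivCompactToT2
    (f := Equiv.ofBijective
      (fun w => (⟨barycenter N.vertex w.1, N.barycenter_mem_dualUnitBall w.1⟩ : N.dualUnitBall))
      ⟨fun w w' h => Subtype.ext (injOn_barycenter w.2 w'.2 (congrArg Subtype.val h)), fun q => by
        obtain ⟨w, hw, hwq⟩ := N.dualUnitBall_subset_image_barycenter q.2
        exact ⟨⟨w, hw⟩, Subtype.ext hwq⟩⟩)
    ((continuous_barycenter.comp continuous_subtype_val).subtype_mk _)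

/-- The homeomorphism from the horofunction compactification onto `B°`: the barycenter map after
the inverse of the max-plus map. -/
def compactificationHomeomorph : N.horofunctionCompactification ≃ₜ N.dualUnitBall :=
  (Homeomorph.setCongr N.horofunctionCompactification_eq_image).trans
    ((N.isClosedEmbedding_maxPlusClass_vertex.isEmbedding.homeomorphImage _).symm.trans
      N.barycenterHomeomorph)

theorem compactificationHomeomorph_apply {ξ : N.horofunctionCompactification}
    {w : stdSimplex ℝ N.Vertex} (h : (ξ : FunctionsModConstants X) = maxPlusClass N.vertex w) :
    (N.compactificationHomeomorph ξ : StrongDual ℝ X) = barycenter N.vertex w := by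
  have hw : w ∈ closure (range (gibbsUniv N.vertex)) := by
    obtain ⟨w', hw', h'⟩ := N.horofunctionCompactification_eq_image.le ξ.2
    rwa [← N.isClosedEmbedding_maxPlusClass_vertex.injective (h'.trans h)]
  have h1 : Homeomorph.setCongr N.horofunctionCompactification_eq_image ξ =
      N.isClosedEmbedding_maxPlusClass_vertex.isEmbedding.homeomorphImage _ ⟨w, hw⟩ :=
    Subtype.ext h
  rw [compactificationHomeomorph, Homeomorph.trans_apply, Homeomorph.trans_apply, h1,
    Homeomorph.symm_apply_apply]
  rfl

end PolyhedralNorm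

end

/-- `X` is a finite-dimensional real vector space with an auxiliary Euclidean inner product (an
identification of `X` with `ℝ^m`), which serves for the topology and for orthogonal complements
only; `N` is the polyhedral norm. -/
theorem theorem1p2 {X : Type*} [NormedAddCommGroup X] [InnerProductSpace ℝ X]
    [FiniteDimensional ℝ X] (N : PolyhedralNorm X) :
    IsEmbedding N.psi ∧
    N.horofunctionBoundary =
      {ξ | ∃ E : N.ProperDualFace, ∃ p ∈ E.parameterSpace, ξ = E.horofunctionClass p} ∧
    ∃ m : N.horofunctionCompactification ≃ₜ N.dualUnitBall,
      (∀ (ξ : N.horofunctionCompactification) (x : X),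
        (ξ : FunctionsModConstants X) = N.psi x →
          (m ξ : StrongDual ℝ X) = momentMap N.dualUnitBall x) ∧
      (∀ (ξ : N.horofunctionCompactification) (E : N.ProperDualFace), ∀ p ∈ E.parameterSpace,
        (ξ : FunctionsModConstants X) = E.horofunctionClass p →
          (m ξ : StrongDual ℝ X) = momentMap E.carrier p) := by
  refine ⟨N.isEmbedding_psi, N.horofunctionBoundary_eq, N.compactificationHomeomorph,
    fun ξ x hξ => ?_, fun ξ E p _ hξ => ?_⟩
  · rw [N.compactificationHomeomorph_apply (hξ.trans (congrFun N.psi_eq_maxPlusClass x))]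
    refine (momentMap_eq_barycenter_gibbs Subtype.val_injective ?_).symm
    rw [Finset.coe_univ, image_univ, Subtype.range_coe]
  · rw [N.compactificationHomeomorph_apply (hξ.trans (E.horofunctionClass_eq p))]
    exact (momentMap_eq_barycenter_gibbs Subtype.val_injective
      (PolyhedralNorm.extremePoints_eq_image E.isExposed)).symm
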